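/- Let $n\ge 0$ be an integer. For $M\in\mathbb{C}^{n\times n}$ define the scaled relative graph $$\mathrm{SRG}(M)=\left\{\frac{\|y\|}{\|x\|}\exp\left(\pm i\arccos\frac{\operatorname{Re}\langle x,y\rangle}{\|x\|\,\|y\|}\right) : x\in\mathbb{C}^n,\ y=Mx\neq 0\right\}\subseteq\mathbb{C},$$ where $\|\cdot\|$ is the Euclidean norm and $\langle x,y\rangle=x^*y$. For $\theta\in\mathbb{R}$ define the $\theta$-SRG by $\mathrm{SRG}_\theta(M)=e^{i\theta}\,\mathrm{SRG}(e^{-i\theta}M)$, and call the line $e^{i\theta}\mathbb{R}\subseteq\mathbb{C}$ the $\theta$-axis. Proposition. Let $A,B\in\mathbb{C}^{n\times n}$ and $\theta\in\mathbb{R}$. Then $\mathrm{SRG}_\theta(A)\cap\mathrm{SRG}_\theta(B)=\emptyset$ if and only if there exists a closed disc $D\subseteq\mathbb{C}$ (of finite positive radius) centered on the $\theta$-axis such that one of $\mathrm{SRG}_\theta(A)$ and $\mathrm{SRG}_\theta(B)$ is contained in $D$ and the other is contained in the complement $\mathbb{C}\setminus D$. The same equivalence holds under the convention in which the scaled relative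 graph also contains the point $0$ whenever the matrix is singular, that is, with $\mathrm{SRG}_\theta(M)$ replaced throughout by $\mathrm{SRG}_\theta(M)\cup\{0\}$ for every singular $M$ (and left unchanged for nonsingular $M$). -/

import Mathlib

noncomputable section

/-- The two points `(‖y‖ / ‖x‖) * exp (± i * arccos (Re ⟪x, y⟫ / (‖x‖ ‖y‖)))` attached to an
input-output pair `(x, y)`. For `x ≠ 0` and `y = 0` this set is `{0}`. -/
def srgPoints {n : ℕ} (x y : EuclideanSpace ℂ (Fin n)) : Set ℂ :=
  {z | ∃ s : ℝ, (s = 1 ∨ s = -1) ∧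
    z = ((‖y‖ / ‖x‖ : ℝ) : ℂ) *
      Complex.exp (Complex.I *
        ((s * Real.arccos ((inner ℂ x y).re / (‖x‖ * ‖y‖)) : ℝ) : ℂ))}

/-- The scaled relative graph of `A`: the union of the points attached to all pairs
`(x, y)` in the graph of `A` (that is, `y = A x`) with `y ≠ 0`. -/
def scaledRelativeGraph {n : ℕ} (A : Matrix (Fin n) (Fin n) ℂ) : Set ℂ :=
  {z | ∃ x y : EuclideanSpace ℂ (Fin n),
    (x, y) ∈ (Matrix.toEuclideanLin A).graph ∧ y ≠ 0 ∧ z ∈ srgPoints x y}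

/-- The scaled relative graph of `A` with the pairs `(x, 0)`, `x ≠ 0`, allowed as well: this
adds the point `0` exactly when `A` is singular, so that all eigenvalues of `A` are included. -/
def scaledRelativeGraphWithZero {n : ℕ} (A : Matrix (Fin n) (Fin n) ℂ) : Set ℂ :=
  {z | ∃ x y : EuclideanSpace ℂ (Fin n),
    (x, y) ∈ (Matrix.toEuclideanLin A).graph ∧ x ≠ 0 ∧ z ∈ srgPoints x y}

/-- The `θ`-SRG of `A`: `exp (i θ) * SRG (exp (-i θ) A)`. -/
def thetaSRG {n : ℕ} (θ : ℝ) (A : Matrix (Fin n) (Fin n) ℂ) : Set ℂ :=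
  (fun z : ℂ => Complex.exp (Complex.I * θ) * z) ''
    scaledRelativeGraph (Complex.exp (-(Complex.I * θ)) • A)

/-- The `θ`-SRG of `A`, with the point `0` included when `A` is singular. -/
def thetaSRGWithZero {n : ℕ} (θ : ℝ) (A : Matrix (Fin n) (Fin n) ℂ) : Set ℂ :=
  (fun z : ℂ => Complex.exp (Complex.I * θ) * z) ''
    scaledRelativeGraphWithZero (Complex.exp (-(Complex.I * θ)) • A)

/-- The `θ`-axis: the line `exp (i θ) ℝ` in the complex plane. -/
def thetaAxis (θ : ℝ) : Set ℂ :=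
  {z | ∃ t : ℝ, z = Complex.exp (Complex.I * θ) * (t : ℂ)}

/-- Some closed disc (of finite positive radius) centered on the `θ`-axis contains one of the
sets `S`, `T`, while the other one lies in its complement. -/
def SeparatedByDisc (θ : ℝ) (S T : Set ℂ) : Prop :=
  ∃ c ∈ thetaAxis θ, ∃ r : ℝ, 0 < r ∧
    ((S ⊆ Metric.closedBall c r ∧ T ⊆ (Metric.closedBall c r)ᶜ) ∨
      (T ⊆ Metric.closedBall c r ∧ S ⊆ (Metric.closedBall c r)ᶜ))

end

/-! The map `z ↦ (Re z, ‖z‖²)` (`normSqLift`) turns circles centred on the real axis into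
non-vertical lines, with the disc below. After rotating by `θ`, each SRG with zero is the full
preimage of `gainRange`, a joint numerical range that is compact and, by Toeplitz–Hausdorff, convex.
Disjoint compact convex sets are strictly separated by a line, which can be tilted off the vertical
and pulled back to a circle.

Without zero, each range loses at most the point `0`. This matters only when both ranges contain
`0`. Then the slopes `re / im` form two disjoint intervals; a one-sided bound makes each compact, so
there is a gap, and a line through `0` separates the ranges. -/

/-! ### Toeplitz–Hausdorff. -/

section NumericalRange

variable {E : Type*} [NormedAddCommGroup E] [InnerProductSpace ℂ E]

/-- The numerical range of a linear operator. -/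
def numericalRange (T : E →ₗ[ℂ] E) : Set ℂ :=
  (fun x => inner ℂ x (T x)) '' Metric.sphere (0 : E) 1

theorem inner_smul_map_smul (T : E →ₗ[ℂ] E) (c : ℂ) (x : E) :
    inner ℂ (c • x) (T (c • x)) = ((‖c‖ ^ 2 : ℝ) : ℂ) * inner ℂ x (T x) := by
  rw [map_smul, inner_smul_left, inner_smul_right, ← mul_assoc, ← Complex.normSq_eq_conj_mul_self,
    Complex.normSq_eq_norm_sq]

theorem exists_inner_map_eq_mul_norm_sq [FiniteDimensional ℂ E] (S : E →ₗ[ℂ] E) {x y : E}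
    (hxS : inner ℂ x (S x) = 0) (hx : ‖x‖ = 1) (hy : ‖y‖ = 1)
    (hyS : inner ℂ y (S y) = 1) {t : ℝ} (ht0 : 0 ≤ t) (ht1 : t ≤ 1) :
    ∃ z : E, z ≠ 0 ∧ inner ℂ z (S z) = ((t * ‖z‖ ^ 2 : ℝ) : ℂ) := by
  -- The phase `c` makes the cross terms real, so the form is real along the segment from `c • x` to
  -- `y` and the intermediate value theorem applies.
  obtain ⟨c, hc, hcw⟩ := RCLike.exists_norm_eq_mul_self
    (inner ℂ y (S x) - (starRingEnd ℂ) (inner ℂ x (S y)))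
  set x' := c • x with hx'
  have hx'S : inner ℂ x' (S x') = 0 := by rw [hx', inner_smul_map_smul, hxS, mul_zero]
  have hx'n : ‖x'‖ = 1 := by rw [hx', norm_smul, hc, hx, mul_one]
  have hcross : (inner ℂ x' (S y) + inner ℂ y (S x')).im = 0 := by
    have h : (c * (inner ℂ y (S x) - (starRingEnd ℂ) (inner ℂ x (S y)))).im = 0 := by
      rw [← hcw]; exact Complex.ofReal_im _
    rw [hx', map_smul, inner_smul_left, inner_smul_right]
    simp only [Complex.mul_im, Complex.add_im, Complex.sub_im, Complex.sub_re, Complex.conj_re,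
      Complex.conj_im] at h ⊢
    linarith
  let z : ℝ → E := fun s => ((1 - s : ℝ) : ℂ) • x' + (s : ℂ) • y
  have hzS (s : ℝ) : inner ℂ (z s) (S (z s)) =
      (((1 - s) * s : ℝ) : ℂ) * (inner ℂ x' (S y) + inner ℂ y (S x')) + ((s ^ 2 : ℝ) : ℂ) := by
    simp only [z, map_add, map_smul, inner_add_left, inner_add_right, inner_smul_left,
      inner_smul_right, Complex.conj_ofReal, hx'S, hyS]
    push_cast
    ring
  have hz0 (s : ℝ) : z s ≠ 0 := by
    intro h
    by_cases hs : s = 0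
    · have : x' = 0 := by simpa [z, hs] using h
      simp [this] at hx'n
    · have hsy : (s : ℂ) • y = (-((1 - s : ℝ) : ℂ)) • x' := by
        rw [neg_smul]; exact eq_neg_of_add_eq_zero_right h
      have h2 := inner_smul_map_smul S (s : ℂ) y
      rw [hsy, inner_smul_map_smul, hx'S, hyS, mul_zero, mul_one] at h2
      have h3 : ‖(s : ℂ)‖ ^ 2 = 0 := by exact_mod_cast h2.symm
      simp [hs] at h3
  have hcont : Continuous fun s : ℝ => (inner ℂ (z s) (S (z s))).re - t * ‖z s‖ ^ 2 := by
    have hS := S.continuous_of_finiteDimensional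
    fun_prop
  have hmem : (0 : ℝ) ∈ Set.Icc ((inner ℂ (z 0) (S (z 0))).re - t * ‖z 0‖ ^ 2)
      ((inner ℂ (z 1) (S (z 1))).re - t * ‖z 1‖ ^ 2) := by
    constructor
    · simp [z, hx'S, hx'n, ht0]
    · simp [z, hyS, hy, ht1]
  obtain ⟨s, -, hs⟩ := intermediate_value_Icc zero_le_one hcont.continuousOn hmem
  refine ⟨z s, hz0 s, Complex.ext ?_ ?_⟩
  · rw [Complex.ofReal_re]; exact sub_eq_zero.1 hs
  · rw [Complex.ofReal_im, hzS, Complex.add_im, Complex.im_ofReal_mul, hcross, Complex.ofReal_im]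
    simp

/-- The **Toeplitz–Hausdorff theorem**. -/
theorem convex_numericalRange [FiniteDimensional ℂ E] (T : E →ₗ[ℂ] E) :
    Convex ℝ (numericalRange T) := by
  rw [convex_iff_segment_subset]
  rintro p ⟨x, hx, hxp⟩ q ⟨y, hy, hyq⟩ w hw
  rw [segment_eq_image'] at hw
  obtain ⟨t, ⟨ht0, ht1⟩, rfl⟩ := hw
  have hx1 : ‖x‖ = 1 := by simpa using hx
  have hy1 : ‖y‖ = 1 := by simpa using hy
  dsimp only at hxp hyq ⊢
  by_cases hpq : p = q
  · subst hpq
    exact ⟨x, hx, by simpa using hxp⟩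
  have hqp : q - p ≠ 0 := sub_ne_zero.2 (Ne.symm hpq)
  have hS (z : E) : inner ℂ z (((q - p)⁻¹ • (T - p • LinearMap.id) : E →ₗ[ℂ] E) z) =
      (q - p)⁻¹ * (inner ℂ z (T z) - p * ((‖z‖ ^ 2 : ℝ) : ℂ)) := by
    simp [inner_self_eq_norm_sq_to_K]
  obtain ⟨z, hz0, hz⟩ := exists_inner_map_eq_mul_norm_sq ((q - p)⁻¹ • (T - p • LinearMap.id))
    (by rw [hS, hxp, hx1]; simp) hx1 hy1 (by rw [hS, hyq, hy1]; simp [hqp]) ht0 ht1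
  rw [hS] at hz
  have hzn : ‖z‖ ≠ 0 := norm_ne_zero_iff.2 hz0
  refine ⟨((‖z‖⁻¹ : ℝ) : ℂ) • z, ?_, ?_⟩
  · simp [norm_smul, hzn]
  · dsimp only
    have hz' : inner ℂ z (T z) = ((‖z‖ ^ 2 : ℝ) : ℂ) * (p + t * (q - p)) := by
      field_simp at hz
      push_cast at hz ⊢
      linear_combination hz
    have hcancel : ((‖((‖z‖⁻¹ : ℝ) : ℂ)‖ ^ 2 : ℝ) : ℂ) * ((‖z‖ ^ 2 : ℝ) : ℂ) = 1 := by
      rw [← Complex.ofReal_mul, Complex.norm_real]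
      simp [hzn]
    rw [inner_smul_map_smul, hz', ← mul_assoc, hcancel, one_mul]
    simp

end NumericalRange

/-! ### Separation by lines and circles. -/

section Circle

/-- The parameters `c`, `r` of a disc `‖z - c‖ ≤ r` that contains all `z` with
`z.re + ‖z‖ ^ 2 * I` in `P` and no `z` with `z.re + ‖z‖ ^ 2 * I` in `Q`. -/
def CircleSeparates (P Q : Set ℂ) : Prop :=
  ∃ c r : ℝ, 0 < r ∧ (∀ w ∈ P, w.im - 2 * c * w.re + c ^ 2 ≤ r ^ 2) ∧
    ∀ w ∈ Q, r ^ 2 < w.im - 2 * c * w.re + c ^ 2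

theorem CircleSeparates.mono {P Q P' Q' : Set ℂ} (h : CircleSeparates P Q) (hP : P' ⊆ P)
    (hQ : Q' ⊆ Q) : CircleSeparates P' Q' := by
  obtain ⟨c, r, hr, h1, h2⟩ := h
  exact ⟨c, r, hr, fun w hw => h1 w (hP hw), fun w hw => h2 w (hQ hw)⟩

/-- Completing the square gives `c = -a/2` and `r² = u + c²`. -/
theorem CircleSeparates.of_linear {P Q : Set ℂ} {a u : ℝ} (hu : 0 < u + (a / 2) ^ 2)
    (hP : ∀ w ∈ P, w.im + a * w.re ≤ u) (hQ : ∀ w ∈ Q, u < w.im + a * w.re) :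
    CircleSeparates P Q := by
  refine ⟨-(a / 2), √(u + (a / 2) ^ 2), Real.sqrt_pos.2 hu, fun w hw => ?_, fun w hw => ?_⟩ <;>
    rw [Real.sq_sqrt hu.le]
  · linarith [hP w hw]
  · linarith [hQ w hw]

theorem CircleSeparates.of_bounded_empty {P : Set ℂ} (hP : Bornology.IsBounded P) :
    CircleSeparates P ∅ := by
  obtain ⟨M, hM⟩ := hP.exists_norm_le
  refine .of_linear (a := 0) (u := |M| + 1) (by positivity) (fun w hw => ?_) (by simp)
  have := hM w hw
  linarith [Complex.abs_im_le_norm w, le_abs_self w.im, le_abs_self M]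

/-- The radius is positive because a point of `P`, lying on or above the parabola `im = re²`, lies
strictly below the line. -/
theorem CircleSeparates.of_strict {P Q : Set ℂ} (hPne : P.Nonempty)
    (hpar : ∀ w ∈ P, w.re ^ 2 ≤ w.im) {a b u : ℝ} (hb : 0 < b)
    (hP : ∀ w ∈ P, a * w.re + b * w.im < u) (hQ : ∀ w ∈ Q, u < a * w.re + b * w.im) :
    CircleSeparates P Q := by
  have key (w : ℂ) : w.im + a / b * w.re = (a * w.re + b * w.im) / b := by field_simp; ring
  refine .of_linear (a := a / b) (u := u / b) ?_ (fun w hw => ?_) (fun w hw => ?_)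
  · obtain ⟨w, hw⟩ := hPne
    have h1 : w.im + a / b * w.re < u / b := by
      rw [key]; exact div_lt_div_of_pos_right (hP w hw) hb
    nlinarith [hpar w hw, sq_nonneg (w.re + a / b / 2)]
  · rw [key]; exact (div_lt_div_of_pos_right (hP w hw) hb).le
  · rw [key]; exact div_lt_div_of_pos_right (hQ w hw) hb

theorem exists_strict_separation {P Q : Set ℂ} (hP : Convex ℝ P) (hPc : IsCompact P)
    (hQ : Convex ℝ Q) (hQc : IsCompact Q) (hd : Disjoint P Q) :
    ∃ a b u : ℝ, b ≠ 0 ∧ (∀ w ∈ P, a * w.re + b * w.im < u) ∧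
      ∀ w ∈ Q, u < a * w.re + b * w.im := by
  obtain ⟨f, u, v, hPf, huv, hQf⟩ :=
    geometric_hahn_banach_compact_closed hP hPc hQ hQc.isClosed hd
  have hf (w : ℂ) : f w = f 1 * w.re + f Complex.I * w.im := by
    have : w = w.re • (1 : ℂ) + w.im • Complex.I := by simp
    conv_lhs => rw [this]
    rw [map_add, map_smul, map_smul, smul_eq_mul, smul_eq_mul]
    ring
  by_cases hb : f Complex.I = 0
  · obtain ⟨M, hM⟩ := (hPc.union hQc).isBounded.exists_norm_le
    have hM' (w : ℂ) (hw : w ∈ P ∪ Q) : |w.im| ≤ |M| + 1 := by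
      linarith [Complex.abs_im_le_norm w, hM w hw, le_abs_self M]
    have hN : 0 < |M| + 1 := by positivity
    -- A vertical separating line is tilted by `e`, so small that the functional moves by at most
    -- half the gap on both sets.
    set e := (v - u) / 2 / (|M| + 1)
    have heN : e * (|M| + 1) = (v - u) / 2 := div_mul_cancel₀ _ hN.ne'
    have he0 : 0 < e := div_pos (by linarith) hN
    refine ⟨f 1, e, (u + v) / 2, he0.ne', fun w hw => ?_, fun w hw => ?_⟩
    · have h1 := hPf w hw
      rw [hf, hb] at h1
      nlinarith [(abs_le.1 (hM' w (.inl hw))).2]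
    · have h1 := hQf w hw
      rw [hf, hb] at h1
      nlinarith [(abs_le.1 (hM' w (.inr hw))).1]
  · refine ⟨f 1, f Complex.I, u, hb, fun w hw => hf w ▸ hPf w hw, fun w hw => ?_⟩
    rw [← hf]; exact huv.trans (hQf w hw)

theorem circleSeparates_or_of_compact {P Q : Set ℂ} (hP : Convex ℝ P) (hPc : IsCompact P)
    (hPpar : ∀ w ∈ P, w.re ^ 2 ≤ w.im) (hQ : Convex ℝ Q) (hQc : IsCompact Q)
    (hQpar : ∀ w ∈ Q, w.re ^ 2 ≤ w.im) (hd : Disjoint P Q) :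
    CircleSeparates P Q ∨ CircleSeparates Q P := by
  obtain rfl | hPne := P.eq_empty_or_nonempty
  · exact .inr (.of_bounded_empty hQc.isBounded)
  obtain rfl | hQne := Q.eq_empty_or_nonempty
  · exact .inl (.of_bounded_empty hPc.isBounded)
  obtain ⟨a, b, u, hb, h1, h2⟩ := exists_strict_separation hP hPc hQ hQc hd
  obtain hb | hb := hb.lt_or_gt
  · exact .inr (.of_strict (a := -a) (b := -b) (u := -u) hQne hQpar (by linarith)
      (fun w hw => by linarith [h2 w hw]) (fun w hw => by linarith [h1 w hw]))
  · exact .inl (.of_strict hPne hPpar hb h1 h2)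

end Circle

/-! ### Slopes seen from the origin. -/

section Slope

theorem isPreconnected_slope {P : Set ℂ} (hP : Convex ℝ P) :
    IsPreconnected ((fun w : ℂ => w.re / w.im) '' {w ∈ P | 0 < w.im}) := by
  have hconv : Convex ℝ {w ∈ P | 0 < w.im} := hP.inter (convex_halfSpace_im_gt 0)
  refine hconv.isPreconnected.image _ (ContinuousOn.div ?_ ?_ fun w hw => hw.2.ne') <;>
    fun_prop

/-- Points of equal slope lie on one ray from `0`; the lower is on the segment from `0` to the
higher, hence in both sets. -/
theorem disjoint_slope {P Q : Set ℂ} (hP : Convex ℝ P) (hP0 : 0 ∈ P) (hQ : Convex ℝ Q)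
    (hQ0 : 0 ∈ Q) (hd : Disjoint {w ∈ P | 0 < w.im} {w ∈ Q | 0 < w.im}) :
    Disjoint ((fun w : ℂ => w.re / w.im) '' {w ∈ P | 0 < w.im})
      ((fun w : ℂ => w.re / w.im) '' {w ∈ Q | 0 < w.im}) := by
  have key {P Q : Set ℂ} (hP : Convex ℝ P) (hP0 : 0 ∈ P)
      (hd : Disjoint {w ∈ P | 0 < w.im} {w ∈ Q | 0 < w.im}) {w v : ℂ} (hw : w ∈ P)
      (hw0 : 0 < w.im) (hv : v ∈ Q) (hv0 : 0 < v.im) (h : w.re / w.im = v.re / v.im)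
      (hle : v.im ≤ w.im) : False := by
    have hvw : v = (v.im / w.im) • w := by
      apply Complex.ext
      · rw [Complex.smul_re, smul_eq_mul]
        field_simp at h ⊢
        linarith
      · rw [Complex.smul_im, smul_eq_mul]
        field_simp
    refine Set.disjoint_left.1 hd ⟨?_, hv0⟩ ⟨hv, hv0⟩
    rw [hvw]
    exact hP.smul_mem_of_zero_mem hP0 hw ⟨by positivity, (div_le_one hw0).2 hle⟩
  rw [Set.disjoint_left]
  rintro _ ⟨w, ⟨hw, hw0⟩, rfl⟩ ⟨v, ⟨hv, hv0⟩, h⟩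
  obtain hle | hle := le_total v.im w.im
  · exact key hP hP0 hd hw hw0 hv hv0 h.symm hle
  · exact key hQ hQ0 hd.symm hv hv0 hw hw0 h hle

theorem forall_lt_or_forall_gt_of_disjoint {S T : Set ℝ} (hS : IsPreconnected S)
    (hT : IsPreconnected T) (hd : Disjoint S T) :
    (∀ a ∈ S, ∀ b ∈ T, a < b) ∨ ∀ a ∈ S, ∀ b ∈ T, b < a := by
  have h := ((hS.prod hT).image (fun p : ℝ × ℝ => p.1 - p.2)
    (by fun_prop)).ordConnected
  by_contra! hcon
  obtain ⟨⟨a, ha, b, hb, hab⟩, ⟨a', ha', b', hb', hab'⟩⟩ := hcon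
  obtain ⟨⟨s, t⟩, ⟨hs, ht⟩, hst⟩ := h.out (Set.mem_image_of_mem _ (Set.mk_mem_prod ha' hb'))
    (Set.mem_image_of_mem _ (Set.mk_mem_prod ha hb)) (show (0 : ℝ) ∈ _ from
      ⟨sub_nonpos.2 hab', sub_nonneg.2 hab⟩)
  exact Set.disjoint_left.1 hd hs (sub_eq_zero.1 hst ▸ ht)

/-- The line `re = m * im` gives the circle through `0` with centre `1 / (2m)`, hence `m ≠ 0`; the
sign of `m` decides which set is inside. -/
theorem circleSeparates_or_of_slope_lt {P Q : Set ℂ} (hP : ∀ w ∈ P, 0 < w.im)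
    (hQ : ∀ w ∈ Q, 0 < w.im) {q p : ℝ} (hqp : q < p) (hPq : ∀ w ∈ P, w.re / w.im ≤ q)
    (hQp : ∀ w ∈ Q, p ≤ w.re / w.im) : CircleSeparates P Q ∨ CircleSeparates Q P := by
  obtain ⟨m, hm0, hqm, hmp⟩ : ∃ m : ℝ, m ≠ 0 ∧ q < m ∧ m < p := by
    obtain ⟨m, h1, h2⟩ := exists_between hqp
    by_cases hm : m = 0
    · obtain ⟨m', h3, h4⟩ := exists_between h2
      exact ⟨m', (hm ▸ h3).ne', h1.trans h3, h4⟩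
    · exact ⟨m, hm, h1, h2⟩
  have h1 (w : ℂ) (hw : w ∈ P) : w.re < m * w.im :=
    (div_lt_iff₀ (hP w hw)).1 ((hPq w hw).trans_lt hqm)
  have h2 (w : ℂ) (hw : w ∈ Q) : m * w.im < w.re :=
    (lt_div_iff₀ (hQ w hw)).1 (hmp.trans_le (hQp w hw))
  have hr : 0 < 0 + (-(1 / m) / 2) ^ 2 := by
    have : -(1 / m) / 2 ≠ 0 := by simpa using hm0
    positivity
  have key (w : ℂ) : w.im + -(1 / m) * w.re = (m * w.im - w.re) / m := by field_simp; ring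
  obtain hm | hm := hm0.lt_or_gt
  · refine .inl (.of_linear hr (fun w hw => ?_) fun w hw => ?_) <;> rw [key]
    · exact (div_neg_of_pos_of_neg (sub_pos.2 (h1 w hw)) hm).le
    · exact div_pos_of_neg_of_neg (sub_neg.2 (h2 w hw)) hm
  · refine .inr (.of_linear hr (fun w hw => ?_) fun w hw => ?_) <;> rw [key]
    · exact (div_neg_of_neg_of_pos (sub_neg.2 (h2 w hw)) hm).le
    · exact div_pos (sub_pos.2 (h1 w hw)) hm

end Slope

/-! ### The joint numerical range and its slopes. -/

section Region

variable {E : Type*} [NormedAddCommGroup E] [InnerProductSpace ℂ E]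

/-- The point `Re ⟪x, A x⟫ + ‖A x‖ ^ 2 * I`. -/
noncomputable def gainPoint (A : E →ₗ[ℂ] E) (x : E) : ℂ :=
  ⟨(inner ℂ x (A x)).re, ‖A x‖ ^ 2⟩

/-- The joint numerical range of the Hermitian part of `A` and of `A* A`, as a subset of `ℂ`. -/
noncomputable def gainRange (A : E →ₗ[ℂ] E) : Set ℂ :=
  gainPoint A '' Metric.sphere (0 : E) 1

theorem gainPoint_smul (A : E →ₗ[ℂ] E) (c : ℂ) (x : E) :
    gainPoint A (c • x) = (‖c‖ ^ 2 : ℝ) • gainPoint A x := by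
  apply Complex.ext
  · simp only [gainPoint, Complex.smul_re, inner_smul_map_smul, Complex.re_ofReal_mul, smul_eq_mul]
  · simp only [gainPoint, Complex.smul_im, map_smul, norm_smul, smul_eq_mul, mul_pow]

theorem inv_norm_sq_smul_gainPoint_mem (A : E →ₗ[ℂ] E) {x : E} (hx : x ≠ 0) :
    (‖x‖ ^ 2)⁻¹ • gainPoint A x ∈ gainRange A := by
  refine ⟨((‖x‖⁻¹ : ℝ) : ℂ) • x, by simp [norm_smul, hx], ?_⟩
  rw [gainPoint_smul, Complex.norm_real, norm_inv, norm_norm, inv_pow]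

theorem sq_re_le_im_of_mem_gainRange {A : E →ₗ[ℂ] E} {w : ℂ} (hw : w ∈ gainRange A) :
    w.re ^ 2 ≤ w.im := by
  obtain ⟨x, hx, rfl⟩ := hw
  have hx1 : ‖x‖ = 1 := by simpa using hx
  have h := (Complex.abs_re_le_norm _).trans (norm_inner_le_norm (𝕜 := ℂ) x (A x))
  rw [hx1, one_mul] at h
  exact sq_le_sq.2 (by rwa [abs_norm])

theorem image_slope_gainRange (A : E →ₗ[ℂ] E) :
    (fun w : ℂ => w.re / w.im) '' {w ∈ gainRange A | 0 < w.im} =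
      (fun x => (inner ℂ x (A x)).re / ‖A x‖ ^ 2) '' {x | A x ≠ 0} := by
  apply Set.Subset.antisymm
  · rintro _ ⟨_, ⟨⟨x, hx, rfl⟩, hpos⟩, rfl⟩
    refine ⟨x, fun h => ?_, rfl⟩
    simp [gainPoint, h] at hpos
  · rintro _ ⟨x, hx, rfl⟩
    have hx0 : x ≠ 0 := fun h => hx (by rw [h, map_zero])
    have hxn := norm_pos_iff.2 hx0
    have hAn := norm_pos_iff.2 hx
    refine ⟨_, ⟨inv_norm_sq_smul_gainPoint_mem A hx0, ?_⟩, ?_⟩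
    · simp only [gainPoint, Complex.smul_im, smul_eq_mul]; positivity
    · simp only [gainPoint, Complex.smul_im, Complex.smul_re, smul_eq_mul]
      field_simp

theorem im_pos_of_mem_gainRange {A : E →ₗ[ℂ] E} (h0 : 0 ∉ gainRange A) {w : ℂ}
    (hw : w ∈ gainRange A) : 0 < w.im := by
  have hpar := sq_re_le_im_of_mem_gainRange hw
  refine lt_of_le_of_ne ((sq_nonneg _).trans hpar) fun him => h0 ?_
  have hre : w.re = 0 := by
    rw [← him] at hpar
    exact pow_eq_zero_iff two_ne_zero |>.1 (le_antisymm hpar (sq_nonneg _))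
  rwa [show w = 0 from Complex.ext hre him.symm] at hw

/-- Adding `s • u` to `v` leaves `A v` fixed but changes the left side of the bound linearly in `s`,
so the coefficient must vanish. -/
theorem re_inner_map_eq_zero_of_bounded {A : E →ₗ[ℂ] E} {C : ℝ}
    (hC : ∀ x, A x ≠ 0 → (inner ℂ x (A x)).re ≤ C * ‖A x‖ ^ 2) {u : E} (hu : A u = 0) (v : E) :
    (inner ℂ u (A v)).re = 0 := by
  by_cases hv : A v = 0
  · simp [hv]
  by_contra hne
  have h (s : ℝ) : s * (inner ℂ u (A v)).re + (inner ℂ v (A v)).re ≤ C * ‖A v‖ ^ 2 := by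
    have hA : A ((s : ℂ) • u + v) = A v := by simp [hu]
    have := hC ((s : ℂ) • u + v) (by rwa [hA])
    rw [hA, inner_add_left, inner_smul_left, Complex.conj_ofReal, Complex.add_re,
      Complex.re_ofReal_mul] at this
    exact this
  have h1 := h ((C * ‖A v‖ ^ 2 - (inner ℂ v (A v)).re + 1) / (inner ℂ u (A v)).re)
  rw [div_mul_cancel₀ _ hne] at h1
  linarith

variable [FiniteDimensional ℂ E]

theorem isCompact_gainRange (A : E →ₗ[ℂ] E) : IsCompact (gainRange A) := by
  have : ProperSpace E := FiniteDimensional.proper ℂ E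
  refine (isCompact_sphere (0 : E) 1).image ?_
  have hA := A.continuous_of_finiteDimensional
  have : gainPoint A = fun x => (((inner ℂ x (A x)).re : ℝ) : ℂ) +
      ((‖A x‖ ^ 2 : ℝ) : ℂ) * Complex.I := by
    funext x; exact Complex.mk_eq_add_mul_I _ _
  rw [this]
  fun_prop

theorem convex_gainRange (A : E →ₗ[ℂ] E) : Convex ℝ (gainRange A) := by
  have h : gainRange A = numericalRange
      ((1 / 2 : ℂ) • (A + A.adjoint) + Complex.I • (A.adjoint ∘ₗ A)) := by
    refine Set.image_congr fun x _ => ?_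
    have h1 : inner ℂ x (A.adjoint x) = (starRingEnd ℂ) (inner ℂ x (A x)) := by
      rw [LinearMap.adjoint_inner_right, inner_conj_symm]
    simp only [LinearMap.add_apply, LinearMap.smul_apply, LinearMap.comp_apply, inner_add_right,
      inner_smul_right, h1, LinearMap.adjoint_inner_right, inner_self_eq_norm_sq_to_K]
    rw [Complex.add_conj, gainPoint, Complex.mk_eq_add_mul_I]
    push_cast
    simp
    ring
  rw [h]
  exact convex_numericalRange _

/-- The kernel component of `x` does not affect the slope, so the unit sphere of `(ker A)ᗮ`
suffices; it is compact and `A` has no zero there. -/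
theorem isCompact_slope_of_re_inner_eq_zero {A : E →ₗ[ℂ] E}
    (hA : ∀ u, A u = 0 → ∀ v, (inner ℂ u (A v)).re = 0) :
    IsCompact ((fun x => (inner ℂ x (A x)).re / ‖A x‖ ^ 2) '' {x | A x ≠ 0}) := by
  have : ProperSpace E := FiniteDimensional.proper ℂ E
  have hAc := A.continuous_of_finiteDimensional
  have hne (x : E) (hx : x ∈ Metric.sphere (0 : E) 1 ∩ ((LinearMap.ker A)ᗮ : Submodule ℂ E)) :
      A x ≠ 0 := by
    intro h
    have h0 : inner ℂ x x = 0 := (Submodule.mem_orthogonal _ _).1 hx.2 x h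
    rw [inner_self_eq_zero] at h0
    simp [h0] at hx
  have heq : (fun x => (inner ℂ x (A x)).re / ‖A x‖ ^ 2) '' {x | A x ≠ 0} =
      (fun x => (inner ℂ x (A x)).re / ‖A x‖ ^ 2) ''
        (Metric.sphere (0 : E) 1 ∩ ((LinearMap.ker A)ᗮ : Submodule ℂ E)) := by
    apply Set.Subset.antisymm
    · rintro _ ⟨x, hx, rfl⟩
      obtain ⟨u, hu, v, hv, rfl⟩ := (LinearMap.ker A).exists_add_mem_mem_orthogonal x
      have hu' : A u = 0 := hu
      have hx' : A v ≠ 0 := by simpa [hu'] using hx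
      have hv0 : v ≠ 0 := fun h => hx' (by rw [h, map_zero])
      have hvn := norm_pos_iff.2 hv0
      refine ⟨((‖v‖⁻¹ : ℝ) : ℂ) • v,
        ⟨by simp [norm_smul, hv0], Submodule.smul_mem _ _ hv⟩, ?_⟩
      dsimp only
      rw [inner_smul_map_smul, Complex.re_ofReal_mul, map_smul, norm_smul, mul_pow,
        mul_div_mul_left _ _ (by simp [hv0]), map_add, hu', zero_add, inner_add_left,
        Complex.add_re, hA u hu', zero_add]
    · exact Set.image_mono hne
  rw [heq]
  refine ((isCompact_sphere (0 : E) 1).inter_right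
    (LinearMap.ker A).isClosed_orthogonal).image_of_continuousOn ?_
  refine ContinuousOn.div (by fun_prop) (by fun_prop) fun x hx => ?_
  exact pow_ne_zero _ (norm_ne_zero_iff.2 (hne x hx))

theorem isCompact_slope_of_bddAbove {A : E →ₗ[ℂ] E}
    (h : BddAbove ((fun x => (inner ℂ x (A x)).re / ‖A x‖ ^ 2) '' {x | A x ≠ 0})) :
    IsCompact ((fun x => (inner ℂ x (A x)).re / ‖A x‖ ^ 2) '' {x | A x ≠ 0}) := by
  obtain ⟨C, hC⟩ := h
  refine isCompact_slope_of_re_inner_eq_zero fun u hu v =>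
    re_inner_map_eq_zero_of_bounded (C := C) (fun x hx => ?_) hu v
  exact (div_le_iff₀ (by positivity)).1 (hC ⟨x, hx, rfl⟩)

theorem isCompact_slope_of_bddBelow {A : E →ₗ[ℂ] E}
    (h : BddBelow ((fun x => (inner ℂ x (A x)).re / ‖A x‖ ^ 2) '' {x | A x ≠ 0})) :
    IsCompact ((fun x => (inner ℂ x (A x)).re / ‖A x‖ ^ 2) '' {x | A x ≠ 0}) := by
  obtain ⟨C, hC⟩ := h
  refine isCompact_slope_of_re_inner_eq_zero fun u hu v => ?_
  have := re_inner_map_eq_zero_of_bounded (A := -A) (C := -C) (fun x hx => ?_) (u := u)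
    (by simp [hu]) v
  · simpa using this
  · have hx' : A x ≠ 0 := by simpa using hx
    have h1 := (le_div_iff₀ (by positivity)).1 (hC ⟨x, hx', rfl⟩)
    simp only [LinearMap.neg_apply, inner_neg_right, Complex.neg_re, norm_neg]
    linarith

/-- Each slope set bounds the other on one side, which makes both compact; the attained maximum and
minimum then leave a genuine gap. -/
theorem circleSeparates_or_of_forall_slope_lt {A B : E →ₗ[ℂ] E}
    (hA : {w ∈ gainRange A | 0 < w.im}.Nonempty) (hB : {w ∈ gainRange B | 0 < w.im}.Nonempty)
    (h : ∀ a ∈ (fun w : ℂ => w.re / w.im) '' {w ∈ gainRange A | 0 < w.im},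
      ∀ b ∈ (fun w : ℂ => w.re / w.im) '' {w ∈ gainRange B | 0 < w.im}, a < b) :
    CircleSeparates {w ∈ gainRange A | 0 < w.im} {w ∈ gainRange B | 0 < w.im} ∨
      CircleSeparates {w ∈ gainRange B | 0 < w.im} {w ∈ gainRange A | 0 < w.im} := by
  have hA' := hA.image fun w : ℂ => w.re / w.im
  have hB' := hB.image fun w : ℂ => w.re / w.im
  have hAc : IsCompact ((fun w : ℂ => w.re / w.im) '' {w ∈ gainRange A | 0 < w.im}) := by
    obtain ⟨b, hb⟩ := hB'
    have hbd := show BddAbove _ from ⟨b, fun a ha => (h a ha b hb).le⟩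
    rw [image_slope_gainRange] at hbd ⊢
    exact isCompact_slope_of_bddAbove hbd
  have hBc : IsCompact ((fun w : ℂ => w.re / w.im) '' {w ∈ gainRange B | 0 < w.im}) := by
    obtain ⟨a, ha⟩ := hA'
    have hbd := show BddBelow _ from ⟨a, fun b hb => (h a ha b hb).le⟩
    rw [image_slope_gainRange] at hbd ⊢
    exact isCompact_slope_of_bddBelow hbd
  obtain ⟨q, hq⟩ := hAc.exists_isGreatest hA'
  obtain ⟨p, hp⟩ := hBc.exists_isLeast hB'
  exact circleSeparates_or_of_slope_lt (fun w hw => hw.2) (fun w hw => hw.2)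
    (h q hq.1 p hp.1) (fun w hw => hq.2 ⟨w, hw, rfl⟩) fun w hw => hp.2 ⟨w, hw, rfl⟩

theorem circleSeparates_or_of_disjoint {A B : E →ₗ[ℂ] E}
    (hd : Disjoint (gainRange A) (gainRange B)) :
    CircleSeparates (gainRange A) (gainRange B) ∨ CircleSeparates (gainRange B) (gainRange A) :=
  circleSeparates_or_of_compact (convex_gainRange A) (isCompact_gainRange A)
    (fun _ => sq_re_le_im_of_mem_gainRange) (convex_gainRange B) (isCompact_gainRange B)
    (fun _ => sq_re_le_im_of_mem_gainRange) hd

theorem circleSeparates_or_of_disjoint_pos {A B : E →ₗ[ℂ] E}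
    (hd : Disjoint {w ∈ gainRange A | 0 < w.im} {w ∈ gainRange B | 0 < w.im}) :
    CircleSeparates {w ∈ gainRange A | 0 < w.im} {w ∈ gainRange B | 0 < w.im} ∨
      CircleSeparates {w ∈ gainRange B | 0 < w.im} {w ∈ gainRange A | 0 < w.im} := by
  have bdd (A : E →ₗ[ℂ] E) : Bornology.IsBounded {w ∈ gainRange A | 0 < w.im} :=
    (isCompact_gainRange A).isBounded.subset (Set.sep_subset _ _)
  obtain hA | hA := {w ∈ gainRange A | 0 < w.im}.eq_empty_or_nonempty
  · rw [hA]; exact .inr (.of_bounded_empty (bdd B))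
  obtain hB | hB := {w ∈ gainRange B | 0 < w.im}.eq_empty_or_nonempty
  · rw [hB]; exact .inl (.of_bounded_empty (bdd A))
  by_cases h0 : 0 ∈ gainRange A ∧ 0 ∈ gainRange B
  · have hds := disjoint_slope (convex_gainRange A) h0.1 (convex_gainRange B) h0.2 hd
    obtain h | h := forall_lt_or_forall_gt_of_disjoint (isPreconnected_slope (convex_gainRange A))
      (isPreconnected_slope (convex_gainRange B)) hds
    · exact circleSeparates_or_of_forall_slope_lt hA hB h
    · exact (circleSeparates_or_of_forall_slope_lt hB hA fun b hb a ha => h a ha b hb).symm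
  -- Only `0` can have zero imaginary part, and one range omits it, so the full ranges are disjoint.
  · have hd' : Disjoint (gainRange A) (gainRange B) := by
      rw [Set.disjoint_left] at hd ⊢
      intro w hwA hwB
      have him : 0 < w.im := by
        obtain h | h := not_and_or.1 h0
        · exact im_pos_of_mem_gainRange h hwA
        · exact im_pos_of_mem_gainRange h hwB
      exact hd ⟨hwA, him⟩ ⟨hwB, him⟩
    exact (circleSeparates_or_of_disjoint hd').imp
      (fun h => h.mono (Set.sep_subset _ _) (Set.sep_subset _ _))
      (fun h => h.mono (Set.sep_subset _ _) (Set.sep_subset _ _))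

end Region

/-! ### Transfer to scaled relative graphs. -/

section ScaledRelativeGraph

/-- The map `z ↦ z.re + ‖z‖ ^ 2 * I`, which sends circles centered on the real axis to lines. -/
noncomputable def normSqLift (z : ℂ) : ℂ := ⟨z.re, ‖z‖ ^ 2⟩

/-- Lets disjointness of preimages descend to the ranges. -/
theorem exists_normSqLift_eq {w : ℂ} (hw : w.re ^ 2 ≤ w.im) : ∃ z, normSqLift z = w := by
  refine ⟨⟨w.re, √(w.im - w.re ^ 2)⟩, Complex.ext rfl ?_⟩
  simp only [normSqLift, ← Complex.normSq_eq_norm_sq, Complex.normSq_mk,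
    Real.mul_self_sqrt (sub_nonneg.2 hw)]
  ring

theorem normSqLift_circle (z : ℂ) (c : ℝ) :
    (normSqLift z).im - 2 * c * (normSqLift z).re + c ^ 2 = ‖z - c‖ ^ 2 := by
  simp only [normSqLift, ← Complex.normSq_eq_norm_sq, Complex.normSq_apply, Complex.sub_re,
    Complex.sub_im, Complex.ofReal_re, Complex.ofReal_im]
  ring

theorem mem_srgPoints_iff {n : ℕ} {x y : EuclideanSpace ℂ (Fin n)} (hx : x ≠ 0) (z : ℂ) :
    z ∈ srgPoints x y ↔ z.re = (inner ℂ x y).re / ‖x‖ ^ 2 ∧ ‖z‖ = ‖y‖ / ‖x‖ := by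
  have hxn := norm_pos_iff.2 hx
  constructor
  · rintro ⟨s, hs, rfl⟩
    constructor
    · rw [Complex.re_ofReal_mul, mul_comm Complex.I, Complex.exp_ofReal_mul_I_re]
      have hcos : Real.cos (s * Real.arccos ((inner ℂ x y).re / (‖x‖ * ‖y‖))) =
          (inner ℂ x y).re / (‖x‖ * ‖y‖) := by
        have habs : |(inner ℂ x y).re / (‖x‖ * ‖y‖)| ≤ 1 := by
          rw [abs_div, abs_of_nonneg (by positivity : 0 ≤ ‖x‖ * ‖y‖)]
          exact div_le_one_of_le₀ ((Complex.abs_re_le_norm _).trans (norm_inner_le_norm x y))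
            (by positivity)
        obtain rfl | rfl := hs
        · rw [one_mul, Real.cos_arccos (abs_le.1 habs).1 (abs_le.1 habs).2]
        · rw [neg_one_mul, Real.cos_neg, Real.cos_arccos (abs_le.1 habs).1 (abs_le.1 habs).2]
      rw [hcos]
      by_cases hy : y = 0
      · simp [hy]
      · have hyn := norm_pos_iff.2 hy
        field_simp
    · rw [norm_mul, Complex.norm_exp_I_mul_ofReal, mul_one, Complex.norm_real, Real.norm_eq_abs,
        abs_of_nonneg (by positivity)]
  · rintro ⟨h1, h2⟩
    by_cases hz : z = 0
    · refine ⟨1, .inl rfl, ?_⟩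
      rw [← h2, hz]
      simp
    · have hy : ‖y‖ ≠ 0 := fun h => hz (norm_eq_zero.1 (by rw [h2, h, zero_div]))
      have hratio : (inner ℂ x y).re / (‖x‖ * ‖y‖) = z.re / ‖z‖ := by
        rw [h1, h2]
        field_simp
      have hpolar : z = ((‖z‖ : ℝ) : ℂ) * Complex.exp (Complex.I * (z.arg : ℂ)) := by
        rw [mul_comm Complex.I, Complex.norm_mul_exp_arg_mul_I]
      rw [srgPoints, hratio, ← h2]
      -- Real part and modulus fix `z` up to conjugation; the sign `s` selects the half-plane.
      obtain him | him := le_or_gt 0 z.im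
      · refine ⟨1, .inl rfl, ?_⟩
        rwa [one_mul, ← Complex.arg_of_im_nonneg_of_ne_zero him hz]
      · refine ⟨-1, .inr rfl, ?_⟩
        rwa [neg_one_mul, ← Complex.arg_of_im_neg him]

theorem mem_srgPoints_iff_normSqLift {n : ℕ}
    (A : EuclideanSpace ℂ (Fin n) →ₗ[ℂ] EuclideanSpace ℂ (Fin n))
    {x : EuclideanSpace ℂ (Fin n)} (hx : x ≠ 0) (z : ℂ) :
    z ∈ srgPoints x (A x) ↔ normSqLift z = (‖x‖ ^ 2)⁻¹ • gainPoint A x := by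
  rw [mem_srgPoints_iff hx, Complex.ext_iff, Complex.smul_re, Complex.smul_im]
  refine and_congr (by simp [normSqLift, gainPoint, div_eq_inv_mul]) ?_
  rw [← sq_eq_sq₀ (norm_nonneg _) (by positivity), div_pow]
  simp [normSqLift, gainPoint, div_eq_inv_mul]

theorem scaledRelativeGraphWithZero_eq {n : ℕ} (A : Matrix (Fin n) (Fin n) ℂ) :
    scaledRelativeGraphWithZero A = normSqLift ⁻¹' gainRange (Matrix.toEuclideanLin A) := by
  ext z
  constructor
  · rintro ⟨x, y, hxy, hx, hz⟩
    obtain rfl : y = Matrix.toEuclideanLin A x := hxy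
    rw [Set.mem_preimage, (mem_srgPoints_iff_normSqLift _ hx z).1 hz]
    exact inv_norm_sq_smul_gainPoint_mem _ hx
  · rintro ⟨x, hx, hz⟩
    have hx1 : ‖x‖ = 1 := by simpa using hx
    have hx0 : x ≠ 0 := fun h => by simp [h] at hx1
    refine ⟨x, Matrix.toEuclideanLin A x, (LinearMap.mem_graph_iff _ _).2 rfl, hx0, ?_⟩
    rw [mem_srgPoints_iff_normSqLift _ hx0, ← hz, hx1]
    simp

theorem scaledRelativeGraph_eq {n : ℕ} (A : Matrix (Fin n) (Fin n) ℂ) :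
    scaledRelativeGraph A =
      normSqLift ⁻¹' {w ∈ gainRange (Matrix.toEuclideanLin A) | 0 < w.im} := by
  ext z
  constructor
  · rintro ⟨x, y, hxy, hy, hz⟩
    obtain rfl : y = Matrix.toEuclideanLin A x := hxy
    have hx : x ≠ 0 := fun h => hy (by simp [h])
    rw [Set.mem_preimage, (mem_srgPoints_iff_normSqLift _ hx z).1 hz]
    refine ⟨inv_norm_sq_smul_gainPoint_mem _ hx, ?_⟩
    have hxn := norm_pos_iff.2 hx
    have hyn := norm_pos_iff.2 hy
    simp only [gainPoint, Complex.smul_im, smul_eq_mul]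
    positivity
  · rintro ⟨⟨x, hx, hz⟩, hpos⟩
    have hx1 : ‖x‖ = 1 := by simpa using hx
    have hx0 : x ≠ 0 := fun h => by simp [h] at hx1
    refine ⟨x, Matrix.toEuclideanLin A x, (LinearMap.mem_graph_iff _ _).2 rfl, fun h => ?_, ?_⟩
    · rw [← hz] at hpos
      simp [gainPoint, h] at hpos
    · rw [mem_srgPoints_iff_normSqLift _ hx0, ← hz, hx1]
      simp

theorem SeparatedByDisc.symm {θ : ℝ} {S T : Set ℂ} (h : SeparatedByDisc θ S T) :
    SeparatedByDisc θ T S := by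
  obtain ⟨c, hc, r, hr, h⟩ := h
  exact ⟨c, hc, r, hr, h.symm⟩

theorem SeparatedByDisc.inter_eq_empty {θ : ℝ} {S T : Set ℂ} (h : SeparatedByDisc θ S T) :
    S ∩ T = ∅ := by
  obtain ⟨c, -, r, -, ⟨hS, hT⟩ | ⟨hT, hS⟩⟩ := h
  · exact Set.disjoint_iff_inter_eq_empty.1 (disjoint_compl_right.mono hS hT)
  · exact Set.disjoint_iff_inter_eq_empty.1 (disjoint_compl_left.mono hS hT)

theorem CircleSeparates.separatedByDisc {P Q : Set ℂ} (h : CircleSeparates P Q) (θ : ℝ) :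
    SeparatedByDisc θ ((fun z : ℂ => Complex.exp (Complex.I * θ) * z) '' (normSqLift ⁻¹' P))
      ((fun z : ℂ => Complex.exp (Complex.I * θ) * z) '' (normSqLift ⁻¹' Q)) := by
  obtain ⟨c, r, hr, hP, hQ⟩ := h
  have hdist (z : ℂ) : dist (Complex.exp (Complex.I * θ) * z) (Complex.exp (Complex.I * θ) * c) =
      ‖z - c‖ := by
    rw [dist_eq_norm, ← mul_sub, norm_mul, Complex.norm_exp_I_mul_ofReal, one_mul]
  refine ⟨Complex.exp (Complex.I * θ) * c, ⟨c, rfl⟩, r, hr, .inl ⟨?_, ?_⟩⟩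
  · rintro _ ⟨z, hz, rfl⟩
    have := hP _ hz
    rw [normSqLift_circle, sq_le_sq₀ (norm_nonneg _) hr.le] at this
    rwa [Metric.mem_closedBall, hdist]
  · rintro _ ⟨z, hz, rfl⟩
    have := hQ _ hz
    rw [normSqLift_circle, sq_lt_sq₀ hr.le (norm_nonneg _)] at this
    rwa [Set.mem_compl_iff, Metric.mem_closedBall, hdist, not_le]

theorem inter_eq_empty_iff_separatedByDisc {P Q : Set ℂ} (hP : ∀ w ∈ P, w.re ^ 2 ≤ w.im)
    (h : Disjoint P Q → CircleSeparates P Q ∨ CircleSeparates Q P) (θ : ℝ) :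
    ((fun z : ℂ => Complex.exp (Complex.I * θ) * z) '' (normSqLift ⁻¹' P)) ∩
        ((fun z : ℂ => Complex.exp (Complex.I * θ) * z) '' (normSqLift ⁻¹' Q)) = ∅ ↔
      SeparatedByDisc θ ((fun z : ℂ => Complex.exp (Complex.I * θ) * z) '' (normSqLift ⁻¹' P))
        ((fun z : ℂ => Complex.exp (Complex.I * θ) * z) '' (normSqLift ⁻¹' Q)) := by
  refine ⟨fun hempty => ?_, SeparatedByDisc.inter_eq_empty⟩
  have hd : Disjoint P Q := by
    rw [Set.disjoint_left]
    intro w hwP hwQ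
    obtain ⟨z, rfl⟩ := exists_normSqLift_eq (hP w hwP)
    exact Set.disjoint_left.1 (Set.disjoint_iff_inter_eq_empty.2 hempty) ⟨z, hwP, rfl⟩
      ⟨z, hwQ, rfl⟩
  obtain h | h := h hd
  · exact h.separatedByDisc θ
  · exact (h.separatedByDisc θ).symm

end ScaledRelativeGraph

theorem mainTheorem10 (n : ℕ) (A B : Matrix (Fin n) (Fin n) ℂ) (θ : ℝ) :
    (thetaSRG θ A ∩ thetaSRG θ B = ∅ ↔ SeparatedByDisc θ (thetaSRG θ A) (thetaSRG θ B)) ∧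
    (thetaSRGWithZero θ A ∩ thetaSRGWithZero θ B = ∅ ↔
      SeparatedByDisc θ (thetaSRGWithZero θ A) (thetaSRGWithZero θ B)) := by
  simp only [thetaSRG, thetaSRGWithZero, scaledRelativeGraph_eq, scaledRelativeGraphWithZero_eq]
  exact ⟨inter_eq_empty_iff_separatedByDisc (fun w hw => sq_re_le_im_of_mem_gainRange hw.1)
      circleSeparates_or_of_disjoint_pos θ,
    inter_eq_empty_iff_separatedByDisc (fun w hw => sq_re_le_im_of_mem_gainRange hw)
      circleSeparates_or_of_disjoint θ⟩
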